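/- **Theorem (Computational adequacy).** For every closed pPCF term $M$ of type $\mathrm{nat}$ and every $n\in\mathbb N$, $$[\![M]\!]_n=\mathrm{Prob}^\infty_{M,\underline n},\qquad \mathrm{Prob}^\infty_{M,\underline n}:=\sup_{k\in\mathbb N}\mathrm{Prob}^k_{M,\underline n}.$$ *Language.* Types are $t,u::=\mathrm{nat}\mid u\Rightarrow t$. Terms, taken up to renaming of bound variables, are $$M,N,P,Q::=\underline n\mid x\mid \mathrm{succ}(M)\mid \mathrm{if}(M,P,z\cdot Q)\mid\lambda x^u.M\mid (M)N\mid\mathrm{coin}(\kappa)\mid\mathrm{fix}(M),$$ with $n\in\mathbb N$, $\kappa\in[0,1]\cap\mathbb Q$, typed by the usual rules of the simply typed $\lambda$-calculus together with: $\Gamma\vdash\underline n:\mathrm{nat}$; $\Gamma\vdash\mathrm{coin}(\kappa):\mathrm{nat}$; $\Gamma\vdash\mathrm{succ}(M):\mathrm{nat}$ if $\Gamma\vdash M:\mathrm{nat}$; $\Gamma\vdash\mathrm{fix}(M):t$ if $\Gamma\vdash M:t\Rightarrow t$; and $\Gamma\vdash\mathrm{if}(M,P,z\cdot Q):t$ if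 $\Gamma\vdash M:\mathrm{nat}$, $\Gamma\vdash P:t$ and $\Gamma,z:\mathrm{nat}\vdash Q:t$. *Reduction.* $M\xrightarrow{\kappa}M'$ is generated by $$\mathrm{coin}(\kappa)\xrightarrow{\kappa}\underline 0,\qquad \mathrm{coin}(\kappa)\xrightarrow{1-\kappa}\underline 1,\qquad (\lambda x^u.M)N\xrightarrow{1}M[x\mapsto N],\qquad \mathrm{fix}(M)\xrightarrow{1}(M)\mathrm{fix}(M),$$ $$\mathrm{succ}(\underline n)\xrightarrow{1}\underline{n+1},\qquad \mathrm{if}(\underline 0,P,z\cdot Q)\xrightarrow{1}P,\qquad \mathrm{if}(\underline{n+1},P,z\cdot Q)\xrightarrow{1}Q[z\mapsto\underline n],$$ and, whenever $M\xrightarrow{\kappa}N$, by $(M)P\xrightarrow{\kappa}(N)P$, $\mathrm{succ}(M)\xrightarrow{\kappa}\mathrm{succ}(N)$ and $\mathrm{if}(M,P,z\cdot Q)\xrightarrow{\kappa}\mathrm{if}(N,P,z\cdot Q)$. A term is weak-normal if it has no reduction. Set $\mathrm{Prob}_{M,M'}=\kappa$ if $M\xrightarrow{\kappa}M'$, $\mathrm{Prob}_{M,M'}=1$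 if $M=M'$ is weak-normal, and $\mathrm{Prob}_{M,M'}=0$ otherwise. $\mathrm{Prob}^k$ is the $k$-th power of this matrix, so $\mathrm{Prob}^k_{M,M'}$ is the probability that $M$ reduces to $M'$ in $k$ steps. *Denotation.* A Kegelspitze is a pointed dcpo with subconvex sums $\sum_{i<m}r_i\cdot x_i$ ($r_i\ge0$, $\sum_i r_i\le1$) that obey the unit and substitution laws, have $\bot$ as the empty sum, and are Scott-continuous in $(r_i)_i$ and $(x_i)_i$; a countable sum $\sum_{i\in\mathbb N}r_i\cdot x_i$ is the supremum of its finite partial sums. Types denote Kegelspitzen: $[\![\mathrm{nat}]\!]=\{\varphi:\mathbb N\to[0,1]\mid\sum_n\varphi(n)\le1\}$ with pointwise order and sums, and $[\![u\Rightarrow t]\!]$ is the set of Scott-continuous maps $[\![u]\!]\to[\![t]\!]$ with pointwise order and sums. A context denotes the product of the denotations of its types, and $\Gamma\vdash M:t$ denotes a Scott-continuous map $[\![M]\!]:[\![\Gamma]\!]\to[\![t]\!]$. With $\delta_n$ the Dirac distribution at $n$: $$[\![x_i]\!](\rho)=\rho_i,\qquad [\![\underline n]\!](\rho)=\delta_n,\qquad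 [\![\mathrm{coin}(\kappa)]\!](\rho)=\kappa\,\delta_0+(1-\kappa)\,\delta_1,$$ $$[\![\mathrm{succ}(M)]\!](\rho)=(0,v_0,v_1,\dots)\ \text{ where } v=[\![M]\!](\rho),$$ $$[\![\mathrm{if}(M,P,z\cdot Q)]\!](\rho)=v_0\cdot[\![P]\!](\rho)+\sum_{i\ge0}v_{i+1}\cdot[\![Q]\!](\rho,\delta_i)\ \text{ where } v=[\![M]\!](\rho),$$ $$[\![(M)N]\!](\rho)=[\![M]\!](\rho)\bigl([\![N]\!](\rho)\bigr),\qquad [\![\lambda x^u.M]\!](\rho)(a)=[\![M]\!](\rho,a),\qquad [\![\mathrm{fix}(M)]\!](\rho)=\bigvee_{k}f^k(\bot)\ \text{ where } f=[\![M]\!](\rho).$$ For closed $M$ of type $\mathrm{nat}$, $[\![M]\!]_n$ is the value at $n$ of the subdistribution $[\![M]\!]$. -/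

import Mathlib

open scoped ENNReal

namespace PPCF

/-! ### Subdistributions -/

/-- Subprobability distributions on `ι`: functions `φ : ι → [0, 1]` with `∑ φ ≤ 1`
(the bound on the sum forces every value to be at most `1`). The order is pointwise. -/
structure SubDist (ι : Type) : Type where
  toFun : ι → ℝ≥0∞
  tsum_le : ∑' i, toFun i ≤ 1

namespace SubDist

variable {ι κ μ : Type}

instance : CoeFun (SubDist ι) (fun _ => ι → ℝ≥0∞) := ⟨SubDist.toFun⟩

@[ext] theorem ext {φ ψ : SubDist ι} (h : ∀ i, φ i = ψ i) : φ = ψ := by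
  obtain ⟨f, hf⟩ := φ
  obtain ⟨g, hg⟩ := ψ
  obtain rfl : f = g := funext h
  rfl

instance : PartialOrder (SubDist ι) where
  le φ ψ := ∀ i, φ i ≤ ψ i
  le_refl _ _ := le_rfl
  le_trans _ _ _ h h' i := (h i).trans (h' i)
  le_antisymm _ _ h h' := ext fun i => (h i).antisymm (h' i)

/-- The zero subdistribution. -/
def zero : SubDist ι := ⟨fun _ => 0, by simp⟩

theorem tsum_sup_le {d : Set (SubDist ι)} (hd : DirectedOn (· ≤ ·) d) :
    ∑' i, ⨆ φ : d, (φ : SubDist ι) i ≤ 1 := by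
  rw [ENNReal.tsum_eq_iSup_sum]
  refine iSup_le fun s => ?_
  rw [ENNReal.finsetSum_iSup]
  · exact iSup_le fun φ => (ENNReal.sum_le_tsum s).trans φ.1.tsum_le
  · rintro ⟨φ, hφ⟩ ⟨ψ, hψ⟩
    obtain ⟨χ, hχ, h1, h2⟩ := hd φ hφ ψ hψ
    exact ⟨⟨χ, hχ⟩, fun a => ⟨h1 a, h2 a⟩⟩

open Classical in
/-- Subdistributions form a pointed dcpo: directed suprema are pointwise. (The value of `sSup` on
a set that is not directed is irrelevant.) -/
noncomputable instance : CompletePartialOrder (SubDist ι) where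
  sSup d := if h : DirectedOn (· ≤ ·) d then ⟨fun i => ⨆ φ : d, (φ : SubDist ι) i, tsum_sup_le h⟩ else zero
  bot := zero
  bot_le _ _ := zero_le
  lubOfDirected d hd := by
    rw [dif_pos hd]
    exact ⟨fun φ hφ i => le_iSup (fun φ : d => (φ : SubDist ι) i) ⟨φ, hφ⟩,
      fun ψ hψ i => iSup_le fun φ => hψ φ.2 i⟩

/-- The Dirac distribution `δ i`. -/
noncomputable def dirac (i : ι) : SubDist ι :=
  ⟨fun j => open Classical in if j = i then 1 else 0, by simp⟩

/-- The mixture `∑ i, r i • s i`. -/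
noncomputable def bind (r : SubDist ι) (s : ι → SubDist κ) : SubDist κ :=
  ⟨fun k => ∑' i, r i * s i k, by
    rw [ENNReal.tsum_comm]
    simp_rw [ENNReal.tsum_mul_left]
    calc ∑' i, r i * ∑' k, s i k ≤ ∑' i, r i * 1 :=
          ENNReal.tsum_le_tsum fun i => by gcongr; exact (s i).tsum_le
      _ ≤ 1 := by simpa using r.tsum_le⟩

/-- The first `n` weights of a subdistribution on `ℕ`. -/
noncomputable def trunc (n : ℕ) (v : SubDist ℕ) : SubDist (Fin n) :=
  ⟨fun i => v i, (ENNReal.tsum_comp_le_tsum_of_injective Fin.val_injective v.toFun).trans v.tsum_le⟩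

theorem scott_apply (i : ι) : ScottContinuous (fun φ : SubDist ι => φ i) := by
  rw [CompletePartialOrder.scottContinuous]
  intro d hne hd
  have : sSup d = ⟨fun i => ⨆ φ : d, (φ : SubDist ι) i, tsum_sup_le hd⟩ := dif_pos hd
  simp only [this, Set.image_eq_range]
  exact isLUB_iSup

theorem scott_of_apply {A : Type} [Preorder A] {f : A → SubDist ι}
    (h : ∀ i, ScottContinuous (fun a => f a i)) : ScottContinuous f := by
  intro d hne hd a ha
  refine ⟨?_, fun ψ hψ i => ?_⟩
  · rintro _ ⟨b, hb, rfl⟩ i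
    exact (h i).monotone (ha.1 hb)
  · refine (h i hne hd ha).2 ?_
    rintro _ ⟨b, hb, rfl⟩
    exact hψ ⟨b, hb, rfl⟩ i

end SubDist

/-! ### Scott-continuity of arithmetic and of suprema -/

theorem scott_mul : ScottContinuous (fun p : ℝ≥0∞ × ℝ≥0∞ => p.1 * p.2) := by
  have key : ∀ a : ℝ≥0∞, ScottContinuous (fun b => a * b) := fun a =>
    ScottContinuous.of_map_sSup fun d _ _ => by rw [ENNReal.mul_sSup, sSup_image]
  exact ScottContinuous.fromProd key fun b => by simpa only [mul_comm] using key b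

theorem scott_add : ScottContinuous (fun p : ℝ≥0∞ × ℝ≥0∞ => p.1 + p.2) := by
  have key : ∀ a : ℝ≥0∞, ScottContinuous (fun b => a + b) := fun a =>
    ScottContinuous.of_map_sSup fun d hd _ => by rw [ENNReal.add_sSup hd, sSup_image]
  exact ScottContinuous.fromProd key fun b => by simpa only [add_comm] using key b

theorem scott_sum {A ι : Type} [Preorder A] (s : Finset ι) {f : ι → A → ℝ≥0∞}
    (h : ∀ i, ScottContinuous (f i)) : ScottContinuous (fun a => ∑ i ∈ s, f i a) := by
  classical
  induction s using Finset.induction_on with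
  | empty => simp
  | insert i s hi ih =>
    simp_rw [Finset.sum_insert hi]
    exact ((h i).prodMk ih).comp scott_add

theorem scott_pi {A ι : Type} {X : ι → Type} [Preorder A] [∀ i, Preorder (X i)]
    {f : A → ∀ i, X i} (h : ∀ i, ScottContinuous (fun a => f a i)) : ScottContinuous f := by
  intro d hne hd a ha
  rw [isLUB_pi]
  intro i
  rw [← Set.image_comp]
  exact h i hne hd ha

theorem scott_eval {ι : Type} {X : ι → Type} [∀ i, Preorder (X i)] (i : ι) :
    ScottContinuous (fun x : ∀ i, X i => x i) :=
  fun _ _ _ _ ha => isLUB_pi.1 ha i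

theorem scott_iSup {A X : Type} [Preorder A] [CompletePartialOrder X] {f : ℕ → A → X}
    (hf : ∀ n, ScottContinuous (f n)) (hm : ∀ a, Monotone (fun n => f n a)) :
    ScottContinuous (fun a => ⨆ n, f n a) := by
  have lub : ∀ a, IsLUB (Set.range fun n => f n a) (⨆ n, f n a) := fun a =>
    DirectedOn.isLUB_sSup ((hm a).directed_le.directedOn_range)
  intro d hne hd a ha
  refine ⟨?_, fun y hy => (lub a).2 ?_⟩
  · rintro _ ⟨b, hb, rfl⟩
    refine (lub b).2 ?_
    rintro _ ⟨n, rfl⟩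
    exact ((hf n).monotone (ha.1 hb)).trans ((lub a).1 ⟨n, rfl⟩)
  · rintro _ ⟨n, rfl⟩
    refine (hf n hne hd ha).2 ?_
    rintro _ ⟨b, hb, rfl⟩
    exact ((lub b).1 ⟨n, rfl⟩).trans (hy ⟨b, hb, rfl⟩)

/-! ### Kegelspitzen -/

/-- A Kegelspitze: a pointed dcpo (`CompletePartialOrder` includes the supremum `⊥` of the empty
set) with finite subconvex sums `comb r x = ∑ i, r i • x i` satisfying the unit and the
substitution law, such that the least element is the zero (the empty sum) and the sums are
Scott-continuous in the weights and in the points together. Scalar multiplication is the case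
`n = 1`. -/
class Kegelspitze (X : Type) extends CompletePartialOrder X where
  comb : ∀ {n : ℕ}, SubDist (Fin n) → (Fin n → X) → X
  comb_dirac : ∀ {n : ℕ} (i : Fin n) (x : Fin n → X), comb (SubDist.dirac i) x = x i
  comb_comb : ∀ {m n : ℕ} (r : SubDist (Fin m)) (s : Fin m → SubDist (Fin n)) (x : Fin n → X),
    comb r (fun i => comb (s i) x) = comb (r.bind s) x
  comb_zero : ∀ {n : ℕ} (x : Fin n → X), comb SubDist.zero x = ⊥
  scott_comb : ∀ {n : ℕ},
    ScottContinuous (fun p : SubDist (Fin n) × (Fin n → X) => comb p.1 p.2)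

/-- The countable subconvex sum `∑ i, v i • x i` in a Kegelspitze: the supremum of the
increasing sequence of its finite partial sums. -/
noncomputable def csum {X : Type} [Kegelspitze X] (v : SubDist ℕ) (x : ℕ → X) : X :=
  ⨆ n : ℕ, Kegelspitze.comb (v.trunc n) (fun i : Fin n => x i)

theorem csum_mono {X : Type} [Kegelspitze X] (v : SubDist ℕ) (x : ℕ → X) :
    Monotone (fun n : ℕ => Kegelspitze.comb (v.trunc n) (fun i : Fin n => x i)) := by
  refine monotone_nat_of_le_succ fun n => ?_
  let s : Fin (n + 1) → SubDist (Fin n) :=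
    Fin.lastCases (motive := fun _ => SubDist (Fin n)) SubDist.zero SubDist.dirac
  have hs : v.trunc n = (v.trunc (n + 1)).bind s := by
    ext j
    simp only [SubDist.bind, tsum_fintype, Fin.sum_univ_castSucc, s, Fin.lastCases_castSucc,
      Fin.lastCases_last]
    simp [SubDist.zero, SubDist.dirac, SubDist.trunc]
  rw [hs, ← Kegelspitze.comb_comb]
  refine Kegelspitze.scott_comb.monotone (a := (_, _)) (b := (_, _)) ⟨le_rfl, fun i => ?_⟩
  induction i using Fin.lastCases with
  | last => simp [s, Kegelspitze.comb_zero]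
  | cast i => simp [s, Kegelspitze.comb_dirac]

theorem scott_csum {X : Type} [Kegelspitze X] :
    ScottContinuous (fun p : SubDist ℕ × (ℕ → X) => csum p.1 p.2) := by
  refine scott_iSup (fun n => ?_) (fun p => csum_mono p.1 p.2)
  have h1 : ScottContinuous (fun p : SubDist ℕ × (ℕ → X) => p.1.trunc n) :=
    SubDist.scott_of_apply fun i => ScottContinuous.fst.comp (SubDist.scott_apply (i : ℕ))
  have h2 : ScottContinuous (fun p : SubDist ℕ × (ℕ → X) => fun i : Fin n => p.2 i) :=
    scott_pi fun i => ScottContinuous.snd.comp (scott_eval (i : ℕ))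
  exact (h1.prodMk h2).comp Kegelspitze.scott_comb

/-- The Kegelspitze of subdistributions, with pointwise sums. -/
noncomputable instance {κ : Type} : Kegelspitze (SubDist κ) where
  comb r x := r.bind x
  comb_dirac i x := by ext k; simp [SubDist.bind, SubDist.dirac]
  comb_comb r s x := by
    ext k
    simp only [SubDist.bind, ← ENNReal.tsum_mul_left, ← ENNReal.tsum_mul_right]
    rw [ENNReal.tsum_comm]
    simp only [mul_assoc]
  comb_zero x := by
    ext k
    change ∑' i, 0 * _ = (0 : ℝ≥0∞)
    simp
  scott_comb {_} := SubDist.scott_of_apply fun k => by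
    simp only [SubDist.bind, tsum_fintype]
    refine scott_sum _ fun i => ScottContinuous.comp (ScottContinuous.prodMk ?_ ?_) scott_mul
    · exact ScottContinuous.fst.comp (SubDist.scott_apply i)
    · exact ScottContinuous.snd.comp
        ((scott_eval (X := fun _ => SubDist κ) i).comp (SubDist.scott_apply k))

/-- Scott-continuous maps, ordered pointwise. -/
structure ScottMap (X Y : Type) [Preorder X] [Preorder Y] : Type where
  toFun : X → Y
  scott : ScottContinuous toFun

namespace ScottMap

variable {A X Y : Type}

instance [Preorder X] [Preorder Y] : CoeFun (ScottMap X Y) (fun _ => X → Y) :=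
  ⟨ScottMap.toFun⟩

@[ext] theorem ext [Preorder X] [Preorder Y] {f g : ScottMap X Y} (h : ∀ x, f x = g x) :
    f = g := by
  obtain ⟨f, hf⟩ := f
  obtain ⟨g, hg⟩ := g
  obtain rfl : f = g := funext h
  rfl

instance [Preorder X] [PartialOrder Y] : PartialOrder (ScottMap X Y) where
  le f g := ∀ x, f x ≤ g x
  le_refl _ _ := le_rfl
  le_trans _ _ _ h h' x := (h x).trans (h' x)
  le_antisymm _ _ h h' := ext fun x => (h x).antisymm (h' x)

theorem directedOn_apply [Preorder X] [PartialOrder Y] {d : Set (ScottMap X Y)}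
    (hd : DirectedOn (· ≤ ·) d) (x : X) :
    DirectedOn (· ≤ ·) ((fun f : ScottMap X Y => f x) '' d) := by
  rintro _ ⟨f, hf, rfl⟩ _ ⟨g, hg, rfl⟩
  obtain ⟨h, hh, h1, h2⟩ := hd f hf g hg
  exact ⟨_, ⟨h, hh, rfl⟩, h1 x, h2 x⟩

theorem scott_sup [Preorder X] [CompletePartialOrder Y] {d : Set (ScottMap X Y)}
    (hd : DirectedOn (· ≤ ·) d) :
    ScottContinuous (fun x => sSup ((fun f : ScottMap X Y => f x) '' d)) := by
  have lub := fun x => (directedOn_apply hd x).isLUB_sSup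
  intro e hne he a ha
  refine ⟨?_, fun y hy => (lub a).2 ?_⟩
  · rintro _ ⟨b, hb, rfl⟩
    refine (lub b).2 ?_
    rintro _ ⟨f, hf, rfl⟩
    exact (f.scott.monotone (ha.1 hb)).trans ((lub a).1 ⟨f, hf, rfl⟩)
  · rintro _ ⟨f, hf, rfl⟩
    refine (f.scott hne he ha).2 ?_
    rintro _ ⟨b, hb, rfl⟩
    exact ((lub b).1 ⟨f, hf, rfl⟩).trans (hy ⟨b, hb, rfl⟩)

open Classical in
/-- Scott-continuous maps into a pointed dcpo form a pointed dcpo with pointwise directed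
suprema. (The value of `sSup` on a set that is not directed is irrelevant.) -/
noncomputable instance [Preorder X] [CompletePartialOrder Y] :
    CompletePartialOrder (ScottMap X Y) where
  sSup d := if h : DirectedOn (· ≤ ·) d then ⟨_, scott_sup h⟩
    else ⟨fun _ => ⊥, ScottContinuous.const ⊥⟩
  bot := ⟨fun _ => ⊥, ScottContinuous.const ⊥⟩
  bot_le _ _ := bot_le
  lubOfDirected d hd := by
    rw [dif_pos hd]
    refine ⟨fun f hf x => (directedOn_apply hd x).isLUB_sSup.1 ⟨f, hf, rfl⟩, fun g hg x => ?_⟩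
    refine (directedOn_apply hd x).isLUB_sSup.2 ?_
    rintro _ ⟨f, hf, rfl⟩
    exact hg hf x

theorem scott_apply [Preorder X] [CompletePartialOrder Y] (x : X) :
    ScottContinuous (fun f : ScottMap X Y => f x) := by
  rw [CompletePartialOrder.scottContinuous]
  intro d hne hd
  have : sSup d = ⟨_, scott_sup hd⟩ := dif_pos hd
  simp only [this]
  exact (directedOn_apply hd x).isLUB_sSup

theorem scott_of_apply [Preorder A] [Preorder X] [PartialOrder Y] {F : A → ScottMap X Y}
    (h : ∀ x, ScottContinuous (fun a => F a x)) : ScottContinuous F := by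
  intro d hne hd a ha
  refine ⟨?_, fun g hg x => ?_⟩
  · rintro _ ⟨b, hb, rfl⟩ x
    exact (h x).monotone (ha.1 hb)
  · refine (h x hne hd ha).2 ?_
    rintro _ ⟨b, hb, rfl⟩
    exact hg ⟨b, hb, rfl⟩ x

/-- Evaluation `(f, x) ↦ f x` is Scott-continuous. -/
theorem scott_ev [Preorder X] [CompletePartialOrder Y] :
    ScottContinuous (fun p : ScottMap X Y × X => p.1 p.2) :=
  ScottContinuous.fromProd (fun f => f.scott) (fun x => scott_apply x)

/-- The Kegelspitze `X ⇒ Y` of Scott-continuous maps, with pointwise sums. -/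
noncomputable instance [Preorder X] [Kegelspitze Y] : Kegelspitze (ScottMap X Y) where
  comb r f := ⟨fun x => Kegelspitze.comb r (fun i => f i x),
    ((ScottContinuous.const r).prodMk (scott_pi fun i => (f i).scott)).comp Kegelspitze.scott_comb⟩
  comb_dirac i f := by ext x; exact Kegelspitze.comb_dirac i _
  comb_comb r s f := by ext x; exact Kegelspitze.comb_comb r s _
  comb_zero f := by ext x; exact Kegelspitze.comb_zero _
  scott_comb {_} := scott_of_apply fun x =>
    (ScottContinuous.fst.prodMk (scott_pi fun i =>
      ScottContinuous.snd.comp ((scott_eval i).comp (scott_apply x)))).comp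
        Kegelspitze.scott_comb

/-- The least fixed point operator `fix f = ⨆ n, fⁿ ⊥`. -/
noncomputable def fix [CompletePartialOrder X] (f : ScottMap X X) : X := ⨆ n : ℕ, f.toFun^[n] ⊥

theorem scott_fix [CompletePartialOrder X] :
    ScottContinuous (fun f : ScottMap X X => f.fix) := by
  refine scott_iSup (fun n => ?_) fun f => monotone_nat_of_le_succ fun n => ?_
  · induction n with
    | zero => exact ScottContinuous.const (α := ScottMap X X) (⊥ : X)
    | succ n ih =>
      simp_rw [Function.iterate_succ_apply']
      exact (ScottContinuous.id.prodMk ih).comp scott_ev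
  · rw [Function.iterate_succ_apply]
    exact f.scott.monotone.iterate n bot_le

end ScottMap

/-- The one-point Kegelspitze. -/
noncomputable instance : Kegelspitze Unit where
  lubOfDirected _ _ := ⟨fun _ _ => le_rfl, fun _ _ => le_rfl⟩
  comb _ _ := ()
  comb_dirac _ _ := rfl
  comb_comb _ _ _ := rfl
  comb_zero _ := rfl
  scott_comb {_} := ScottContinuous.const ()

/-- The product of Kegelspitzen, with componentwise order and sums. -/
noncomputable instance {X Y : Type} [Kegelspitze X] [Kegelspitze Y] : Kegelspitze (X × Y) where
  sSup d := (sSup (Prod.fst '' d), sSup (Prod.snd '' d))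
  lubOfDirected d hd := isLUB_prod.2 ⟨hd.fst.isLUB_sSup, hd.snd.isLUB_sSup⟩
  comb r x := (Kegelspitze.comb r (fun i => (x i).1), Kegelspitze.comb r (fun i => (x i).2))
  comb_dirac i x := by simp [Kegelspitze.comb_dirac]
  comb_comb r s x := by simp [Kegelspitze.comb_comb]
  comb_zero x := by simp only [Kegelspitze.comb_zero]; rfl
  scott_comb {_} := ScottContinuous.prodMk
    ((ScottContinuous.fst.prodMk (scott_pi fun i =>
      ScottContinuous.snd.comp ((scott_eval i).comp ScottContinuous.fst))).comp
        Kegelspitze.scott_comb)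
    ((ScottContinuous.fst.prodMk (scott_pi fun i =>
      ScottContinuous.snd.comp ((scott_eval i).comp ScottContinuous.snd))).comp
        Kegelspitze.scott_comb)

/-- Bundled Kegelspitzen, the objects of the category of Kegelspitzen and Scott-continuous maps. -/
structure KS where
  carrier : Type
  [str : Kegelspitze carrier]

instance : CoeSort KS Type := ⟨KS.carrier⟩

noncomputable instance (K : KS) : Kegelspitze K := K.str

/-! ### The language pPCF -/

/-- Types `t, u ::= nat | t ⇒ u`. -/
inductive Ty : Type
  | nat : Ty
  | arr : Ty → Ty → Ty

/-- Contexts; the most recently bound variable comes first. -/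
abbrev Ctx : Type := List Ty

/-- Typed de Bruijn variables. -/
inductive Var : Ctx → Ty → Type
  | zero {Γ : Ctx} {t : Ty} : Var (t :: Γ) t
  | succ {Γ : Ctx} {t u : Ty} : Var Γ t → Var (u :: Γ) t

/-- `Tm Γ t` is the type of pPCF terms `M`, up to renaming of bound variables, together with a
derivation of `Γ ⊢ M : t`. In `ifz M P Q` the term `Q` has the additional variable `z : nat`. -/
inductive Tm : Ctx → Ty → Type
  | var {Γ : Ctx} {t : Ty} : Var Γ t → Tm Γ t
  | num {Γ : Ctx} : ℕ → Tm Γ Ty.nat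
  | succ {Γ : Ctx} : Tm Γ Ty.nat → Tm Γ Ty.nat
  | ifz {Γ : Ctx} {t : Ty} : Tm Γ Ty.nat → Tm Γ t → Tm (Ty.nat :: Γ) t → Tm Γ t
  | lam {Γ : Ctx} {t u : Ty} : Tm (u :: Γ) t → Tm Γ (Ty.arr u t)
  | app {Γ : Ctx} {t u : Ty} : Tm Γ (Ty.arr u t) → Tm Γ u → Tm Γ t
  | coin {Γ : Ctx} (p : ℚ) (hp : p ∈ Set.Icc (0 : ℚ) 1) : Tm Γ Ty.nat
  | fix {Γ : Ctx} {t : Ty} : Tm Γ (Ty.arr t t) → Tm Γ t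

/-! #### Renaming and capture-avoiding substitution -/

/-- Extend a renaming under a binder. -/
def liftRen {Γ Δ : Ctx} (f : ∀ t, Var Γ t → Var Δ t) {u : Ty} :
    ∀ t, Var (u :: Γ) t → Var (u :: Δ) t
  | _, .zero => .zero
  | _, .succ x => .succ (f _ x)

/-- Rename the free variables of a term. -/
def Tm.rename : ∀ {Γ Δ : Ctx} {t : Ty}, (∀ t, Var Γ t → Var Δ t) → Tm Γ t → Tm Δ t
  | _, _, _, f, .var x => .var (f _ x)
  | _, _, _, _, .num n => .num n
  | _, _, _, f, .succ M => .succ (M.rename f)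
  | _, _, _, f, .ifz M P Q => .ifz (M.rename f) (P.rename f) (Q.rename (liftRen f))
  | _, _, _, f, .lam M => .lam (M.rename (liftRen f))
  | _, _, _, f, .app M N => .app (M.rename f) (N.rename f)
  | _, _, _, _, .coin p hp => .coin p hp
  | _, _, _, f, .fix M => .fix (M.rename f)

/-- Extend a substitution under a binder. -/
def liftSub {Γ Δ : Ctx} (σ : ∀ t, Var Γ t → Tm Δ t) {u : Ty} :
    ∀ t, Var (u :: Γ) t → Tm (u :: Δ) t
  | _, .zero => .var .zero
  | _, .succ x => (σ _ x).rename (fun _ => .succ)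

/-- Simultaneous substitution. -/
def Tm.subst : ∀ {Γ Δ : Ctx} {t : Ty}, (∀ t, Var Γ t → Tm Δ t) → Tm Γ t → Tm Δ t
  | _, _, _, σ, .var x => σ _ x
  | _, _, _, _, .num n => .num n
  | _, _, _, σ, .succ M => .succ (M.subst σ)
  | _, _, _, σ, .ifz M P Q => .ifz (M.subst σ) (P.subst σ) (Q.subst (liftSub σ))
  | _, _, _, σ, .lam M => .lam (M.subst (liftSub σ))
  | _, _, _, σ, .app M N => .app (M.subst σ) (N.subst σ)
  | _, _, _, _, .coin p hp => .coin p hp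
  | _, _, _, σ, .fix M => .fix (M.subst σ)

/-- The substitution that replaces the most recent variable by `N` and fixes the others. -/
def single {Γ : Ctx} {u : Ty} (N : Tm Γ u) : ∀ t, Var (u :: Γ) t → Tm Γ t
  | _, .zero => N
  | _, .succ x => .var x

/-- `M.inst N` is `M[x ↦ N]` for the most recent variable `x` of `M`. -/
def Tm.inst {Γ : Ctx} {t u : Ty} (M : Tm (u :: Γ) t) (N : Tm Γ u) : Tm Γ t := M.subst (single N)

/-! #### Operational semantics -/

/-- `Red M p M'`: the term `M` reduces to `M'` with probability `p`. Deterministic reductions are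
those of probability `1`. -/
inductive Red : ∀ {Γ : Ctx} {t : Ty}, Tm Γ t → ℚ → Tm Γ t → Prop
  | coin_zero {Γ : Ctx} (p : ℚ) (hp : p ∈ Set.Icc (0 : ℚ) 1) :
      Red (Tm.coin (Γ := Γ) p hp) p (.num 0)
  | coin_one {Γ : Ctx} (p : ℚ) (hp : p ∈ Set.Icc (0 : ℚ) 1) :
      Red (Tm.coin (Γ := Γ) p hp) (1 - p) (.num 1)
  | app {Γ : Ctx} {t u : Ty} {M N : Tm Γ (Ty.arr u t)} {p : ℚ} (P : Tm Γ u) :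
      Red M p N → Red (.app M P) p (.app N P)
  | succ {Γ : Ctx} {M N : Tm Γ Ty.nat} {p : ℚ} : Red M p N → Red (.succ M) p (.succ N)
  | ifz {Γ : Ctx} {t : Ty} {M N : Tm Γ Ty.nat} {p : ℚ} (P : Tm Γ t) (Q : Tm (Ty.nat :: Γ) t) :
      Red M p N → Red (.ifz M P Q) p (.ifz N P Q)
  | beta {Γ : Ctx} {t u : Ty} (M : Tm (u :: Γ) t) (N : Tm Γ u) :
      Red (.app (.lam M) N) 1 (M.inst N)
  | fix {Γ : Ctx} {t : Ty} (M : Tm Γ (Ty.arr t t)) : Red (.fix M) 1 (.app M (.fix M))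
  | succ_num {Γ : Ctx} (n : ℕ) : Red (Tm.succ (Γ := Γ) (.num n)) 1 (.num (n + 1))
  | ifz_zero {Γ : Ctx} {t : Ty} (P : Tm Γ t) (Q : Tm (Ty.nat :: Γ) t) :
      Red (.ifz (.num 0) P Q) 1 P
  | ifz_succ {Γ : Ctx} {t : Ty} (n : ℕ) (P : Tm Γ t) (Q : Tm (Ty.nat :: Γ) t) :
      Red (.ifz (.num (n + 1)) P Q) 1 (Q.inst (.num n))

/-- The probability of a reduction step is determined by its two ends. -/
theorem Red.unique {Γ : Ctx} {t : Ty} {M M' : Tm Γ t} {p : ℚ} (h : Red M p M') :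
    ∀ {q : ℚ} {M'' : Tm Γ t}, Red M q M'' → M' = M'' → p = q := by
  induction h with
  | coin_zero => intro q M'' h; cases h <;> simp
  | coin_one => intro q M'' h; cases h <;> simp
  | app P h ih => 
    intro q M'' h'
    cases h' with
    | app _ h2 => intro e; injection e; subst_vars; rename_i e1 _; exact ih h2 (by simp_all)
    | beta => cases h
  | succ h ih => 
    intro q M'' h'
    cases h' with
    | succ h2 => intro e; injection e with e1 e2; exact ih h2 (by assumption)
    | succ_num => cases h
  | ifz P Q h ih =>
    intro q M'' h'
    cases h' with
    | ifz _ _ h2 => intro e; injection e ; exact ih h2 (by assumption)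
    | ifz_zero => cases h
    | ifz_succ => cases h
  | beta => intro q M'' h; cases h; rename_i h; cases h; simp
  | fix => intro q M'' h; cases h; simp
  | succ_num => intro q M'' h; cases h; rename_i h; cases h; simp
  | ifz_zero => intro q M'' h; cases h;  rename_i h; cases h; simp
  | ifz_succ => intro q M'' h; cases h;  rename_i h; cases h; simp

/-- No reduction starts at a weak-normal term. -/
def WeakNormal {Γ : Ctx} {t : Ty} (M : Tm Γ t) : Prop := ∀ p M', ¬ Red M p M'

open Classical in
/-- The stochastic matrix of pPCF terms. (By `Red.unique` there is at most one `p` with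
`Red M p M'`.) -/
noncomputable def prob {Γ : Ctx} {t : Ty} (M M' : Tm Γ t) : ℝ≥0∞ :=
  if h : ∃ p, Red M p M' then ENNReal.ofReal (h.choose : ℚ)
  else if M = M' ∧ WeakNormal M then 1
  else 0

open Classical in
/-- The `k`-th power of the matrix `prob`: the probability that `M` reduces to `M'` in `k` steps. -/
noncomputable def probPow {Γ : Ctx} {t : Ty} : ℕ → Tm Γ t → Tm Γ t → ℝ≥0∞
  | 0, M, M' => if M = M' then 1 else 0
  | k + 1, M, M' => ∑' N : Tm Γ t, prob M N * probPow k N M'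

/-- `Prob^∞`: the supremum over `k` of the `k`-step reduction probabilities. -/
noncomputable def probInf {Γ : Ctx} {t : Ty} (M M' : Tm Γ t) : ℝ≥0∞ := ⨆ k : ℕ, probPow k M M'

/-! #### Denotational semantics -/

/-- `⟦nat⟧` is the Kegelspitze of subdistributions on `ℕ`, and `⟦u ⇒ t⟧` that of
Scott-continuous maps. -/
@[reducible] noncomputable def Ty.den : Ty → KS
  | .nat => ⟨SubDist ℕ⟩
  | .arr u t => ⟨ScottMap (Ty.den u) (Ty.den t)⟩

/-- A context denotes the product of the denotations of its types. -/
@[reducible] noncomputable def Ctx.den : Ctx → KS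
  | [] => ⟨Unit⟩
  | t :: Γ => ⟨t.den × Ctx.den Γ⟩

/-- `(u₀, u₁, …) ↦ (0, u₀, u₁, …)`. -/
noncomputable def shift (u : SubDist ℕ) : SubDist ℕ :=
  ⟨fun n => match n with
    | 0 => 0
    | n + 1 => u n, by
    rw [tsum_eq_zero_add' ENNReal.summable]
    simpa using u.tsum_le⟩

theorem scott_shift : ScottContinuous shift :=
  SubDist.scott_of_apply fun i => by
    cases i with
    | zero => exact ScottContinuous.const (α := SubDist ℕ) (0 : ℝ≥0∞)
    | succ n => exact SubDist.scott_apply n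

/-- `p • δ 0 + (1 - p) • δ 1`. -/
noncomputable def coinDist (p : ℚ) (hp : p ∈ Set.Icc (0 : ℚ) 1) : SubDist ℕ :=
  ⟨fun n => ENNReal.ofReal (p : ℝ) * SubDist.dirac 0 n +
      ENNReal.ofReal (1 - p : ℝ) * SubDist.dirac 1 n, by
    have h0 : (0 : ℝ) ≤ p := by exact_mod_cast hp.1
    have h1 : (0 : ℝ) ≤ 1 - p := by
      have : (p : ℝ) ≤ 1 := by exact_mod_cast hp.2
      linarith
    rw [ENNReal.tsum_add, ENNReal.tsum_mul_left, ENNReal.tsum_mul_left]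
    refine (add_le_add (mul_le_of_le_one_right' (SubDist.dirac 0).tsum_le)
      (mul_le_of_le_one_right' (SubDist.dirac 1).tsum_le)).trans ?_
    rw [← ENNReal.ofReal_add h0 h1]
    simp⟩

/-- The denotation `v₀ • u + ∑ i, v_{i+1} • w(δ i)` of the conditional, where `v` is the value of
the guard, `u` that of the first branch and `w` that of the second branch as a function of the
variable `z`. -/
noncomputable def ifDen {X : Type} [Kegelspitze X] (v : SubDist ℕ) (u : X) (w : SubDist ℕ → X) : X :=
  csum v (fun i => match i with
    | 0 => u
    | i + 1 => w (SubDist.dirac i))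

/-! The operations on Scott-continuous maps that interpret the term constructors; `A` stands for
the denotation of a context. -/

section Operations

variable {A X Y : Type}

/-- Precomposition with the second projection. -/
def ScottMap.weaken [Preorder A] [Preorder X] [Preorder Y] (f : ScottMap A Y) :
    ScottMap (X × A) Y :=
  ⟨fun ρ => f ρ.2, ScottContinuous.snd.comp f.scott⟩

def ScottMap.first [Preorder A] [Preorder X] : ScottMap (X × A) X :=
  ⟨fun ρ => ρ.1, ScottContinuous.fst⟩

def ScottMap.const [Preorder A] [Preorder X] (x : X) : ScottMap A X :=
  ⟨fun _ => x, ScottContinuous.const x⟩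

noncomputable def ScottMap.shift [Preorder A] (f : ScottMap A (SubDist ℕ)) :
    ScottMap A (SubDist ℕ) :=
  ⟨fun ρ => PPCF.shift (f ρ), f.scott.comp scott_shift⟩

noncomputable def ScottMap.cond [Preorder A] [Kegelspitze X] (v : ScottMap A (SubDist ℕ))
    (u : ScottMap A X) (w : ScottMap (SubDist ℕ × A) X) : ScottMap A X :=
  ⟨fun ρ => ifDen (v ρ) (u ρ) (fun z => w (z, ρ)),
    (v.scott.prodMk (scott_pi fun i => by
      cases i with
      | zero => exact u.scott
      | succ i =>
        exact ((ScottContinuous.const (SubDist.dirac i)).prodMk ScottContinuous.id).comp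
          w.scott)).comp scott_csum⟩

def ScottMap.curry [Preorder A] [Preorder X] [PartialOrder Y] (f : ScottMap (X × A) Y) :
    ScottMap A (ScottMap X Y) :=
  ⟨fun ρ => ⟨fun x => f (x, ρ),
      (ScottContinuous.id.prodMk (ScottContinuous.const ρ)).comp f.scott⟩,
    ScottMap.scott_of_apply fun x =>
      ((ScottContinuous.const x).prodMk ScottContinuous.id).comp f.scott⟩

def ScottMap.apply [Preorder A] [Preorder X] [CompletePartialOrder Y]
    (f : ScottMap A (ScottMap X Y)) (g : ScottMap A X) : ScottMap A Y :=
  ⟨fun ρ => f ρ (g ρ), (f.scott.prodMk g.scott).comp ScottMap.scott_ev⟩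

noncomputable def ScottMap.fixed [Preorder A] [CompletePartialOrder X]
    (f : ScottMap A (ScottMap X X)) : ScottMap A X :=
  ⟨fun ρ => (f ρ).fix, f.scott.comp ScottMap.scott_fix⟩

end Operations

/-- A variable denotes a projection. -/
noncomputable def Var.den : ∀ {Γ : Ctx} {t : Ty}, Var Γ t → ScottMap (Ctx.den Γ) (Ty.den t)
  | t :: Γ, _, .zero => ScottMap.first (X := t.den) (A := Ctx.den Γ)
  | u :: Γ, t, .succ x => ScottMap.weaken (X := u.den) (A := Ctx.den Γ) (Y := t.den) x.den

/-- The denotation `⟦Γ ⊢ M : t⟧ : ⟦Γ⟧ → ⟦t⟧`. -/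
noncomputable def Tm.den : ∀ {Γ : Ctx} {t : Ty}, Tm Γ t → ScottMap (Ctx.den Γ) (Ty.den t)
  | _, _, .var x => x.den
  | Γ, _, .num n => ScottMap.const (A := Ctx.den Γ) (SubDist.dirac n)
  | Γ, _, .coin p hp => ScottMap.const (A := Ctx.den Γ) (coinDist p hp)
  | Γ, _, .succ M => ScottMap.shift (A := Ctx.den Γ) M.den
  | Γ, t, .ifz M P Q => ScottMap.cond (A := Ctx.den Γ) (X := t.den) M.den P.den Q.den
  | Γ, _, .lam (t := t) (u := u) M =>
    ScottMap.curry (A := Ctx.den Γ) (X := u.den) (Y := t.den) M.den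
  | Γ, _, .app (t := t) (u := u) M N =>
    ScottMap.apply (A := Ctx.den Γ) (X := u.den) (Y := t.den) M.den N.den
  | Γ, t, .fix M => ScottMap.fixed (A := Ctx.den Γ) (X := t.den) M.den

/-- The subdistribution denoted by a closed term of type `nat`. -/
noncomputable def denNat (M : Tm [] Ty.nat) : SubDist ℕ := M.den ()

end PPCF

namespace PPCF

/-! ### Renaming and substitution -/

section Substitution

variable {Γ Δ Θ : Ctx} {t u : Ty}

/-! Both inequalities rest on one description of a reduction step. A term is either weak-normal, and
then the matrix loops on it, or it reduces to finitely many terms `N i` with weights `r i`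
(`Steps`). In the second case its denotation is the subconvex sum of the denotations of the `N i`
(`weakNormal_or_steps`). This uses the substitution lemma `Tm.den_inst` for the redexes that
substitute, and the fact that the guard of a conditional, the argument of a successor and the
function in an application are linear positions. Induction on the number of steps then bounds every
k-step probability by the denotation.

The converse cannot be an induction on terms at type nat alone, so it uses a logical relation
`Approx` between denotations and closed terms. The relation contains bottom and is closed under
directed suprema, which handles fixed points. It is also closed under backward reduction with
subconvex sums (`Approx.of_steps`), which handles redexes and coins. The delicate case is a term of
type nat inside a frame, that is, a successor or a conditional. There `Approx.frame` replaces the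
value of the term by the subdistributions `reached k M` of numerals obtained in k steps. These
follow the branching of the reduction, so a linear continuous map transports them to the whole
frame. The fundamental lemma `Tm.approx_den`, read at a closed term of type nat, is the missing
inequality. -/

theorem liftRen_comp (f : ∀ t, Var Γ t → Var Δ t) (g : ∀ t, Var Δ t → Var Θ t) :
    (fun t x => liftRen g (u := u) t (liftRen f t x)) = liftRen (fun t x => g t (f t x)) := by
  funext t x
  cases x <;> rfl

theorem Tm.rename_rename (M : Tm Γ t) {Δ Θ : Ctx} (f : ∀ t, Var Γ t → Var Δ t)
    (g : ∀ t, Var Δ t → Var Θ t) :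
    (M.rename f).rename g = M.rename (fun t x => g t (f t x)) := by
  induction M generalizing Δ Θ <;> simp_all [Tm.rename, liftRen_comp]

theorem liftSub_liftRen (f : ∀ t, Var Γ t → Var Δ t) (σ : ∀ t, Var Δ t → Tm Θ t) :
    (fun t x => liftSub σ (u := u) t (liftRen f t x)) = liftSub (fun t x => σ t (f t x)) := by
  funext t x
  cases x <;> rfl

theorem Tm.subst_rename (M : Tm Γ t) {Δ Θ : Ctx} (f : ∀ t, Var Γ t → Var Δ t)
    (σ : ∀ t, Var Δ t → Tm Θ t) :
    (M.rename f).subst σ = M.subst (fun t x => σ t (f t x)) := by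
  induction M generalizing Δ Θ <;> simp_all [Tm.rename, Tm.subst, liftSub_liftRen]

theorem liftSub_rename (σ : ∀ t, Var Γ t → Tm Δ t) (f : ∀ t, Var Δ t → Var Θ t) :
    (fun t x => (liftSub σ (u := u) t x).rename (liftRen f)) =
      liftSub (fun t x => (σ t x).rename f) := by
  funext t x
  cases x
  · rfl
  · simp only [liftSub, Tm.rename_rename]
    rfl

theorem Tm.rename_subst (M : Tm Γ t) {Δ Θ : Ctx} (σ : ∀ t, Var Γ t → Tm Δ t)
    (f : ∀ t, Var Δ t → Var Θ t) :
    (M.subst σ).rename f = M.subst (fun t x => (σ t x).rename f) := by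
  induction M generalizing Δ Θ <;> simp_all [Tm.rename, Tm.subst, liftSub_rename]

theorem liftSub_liftSub (σ : ∀ t, Var Γ t → Tm Δ t) (τ : ∀ t, Var Δ t → Tm Θ t) :
    (fun t x => (liftSub σ (u := u) t x).subst (liftSub τ)) =
      liftSub (fun t x => (σ t x).subst τ) := by
  funext t x
  cases x
  · rfl
  · simp only [liftSub, Tm.subst_rename, Tm.rename_subst]

/-- Under a binder `liftSub` weakens terms by a renaming, so composing two substitutions rests on
the mixed laws `Tm.subst_rename` and `Tm.rename_subst`, and the latter on `Tm.rename_rename`. -/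
theorem Tm.subst_subst (M : Tm Γ t) {Δ Θ : Ctx} (σ : ∀ t, Var Γ t → Tm Δ t)
    (τ : ∀ t, Var Δ t → Tm Θ t) :
    (M.subst σ).subst τ = M.subst (fun t x => (σ t x).subst τ) := by
  induction M generalizing Δ Θ <;> simp_all [Tm.subst, liftSub_liftSub]

theorem liftSub_var :
    liftSub (fun t (x : Var Γ t) => Tm.var x) (u := u) = fun _ x => Tm.var x := by
  funext t x
  cases x <;> rfl

theorem Tm.subst_var (M : Tm Γ t) : M.subst (fun _ x => .var x) = M := by
  induction M <;> simp_all [Tm.subst, liftSub_var]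

/-- Extend a substitution by a term for the most recent variable. -/
def consSub (N : Tm Δ u) (σ : ∀ t, Var Γ t → Tm Δ t) : ∀ t, Var (u :: Γ) t → Tm Δ t
  | _, .zero => N
  | _, .succ x => σ _ x

/-- In the fundamental lemma, contracting a redex under a closing substitution must again give a
closing substitution, so that the induction hypothesis for the body applies. -/
theorem Tm.inst_subst_liftSub (M : Tm (u :: Γ) t) (σ : ∀ t, Var Γ t → Tm Δ t) (N : Tm Δ u) :
    (M.subst (liftSub σ)).inst N = M.subst (consSub N σ) := by
  rw [Tm.inst, Tm.subst_subst]
  congr 1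
  funext t x
  cases x
  · rfl
  · exact (Tm.subst_rename _ _ _).trans (Tm.subst_var _)

/-! ### Denotation of substitutions -/

theorem Tm.den_rename (M : Tm Γ t) {Δ : Ctx} (f : ∀ t, Var Γ t → Var Δ t) (ρ : Ctx.den Γ)
    (ρ' : Ctx.den Δ) (h : ∀ t x, (f t x).den ρ' = x.den ρ) : (M.rename f).den ρ' = M.den ρ := by
  induction M generalizing Δ with
  | var x => exact h _ x
  | num n => rfl
  | coin p hp => rfl
  | succ M ih => exact congrArg PPCF.shift (ih f ρ ρ' h)
  | ifz M P Q ihM ihP ihQ =>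
    have hQ : ∀ z, (Q.rename (liftRen f)).den (z, ρ') = Q.den (z, ρ) := fun z => by
      refine ihQ _ _ _ fun t x => ?_
      cases x
      · rfl
      · exact h _ _
    change ifDen ((M.rename f).den ρ') ((P.rename f).den ρ')
      (fun z => (Q.rename (liftRen f)).den (z, ρ')) = ifDen (M.den ρ) (P.den ρ)
      (fun z => Q.den (z, ρ))
    rw [ihM f ρ ρ' h, ihP f ρ ρ' h]
    congr 1
    exact funext hQ
  | lam M ih =>
    refine ScottMap.ext fun z => ih (liftRen f) (z, ρ) (z, ρ') fun t x => ?_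
    cases x
    · rfl
    · exact h _ _
  | app M N ihM ihN =>
    change ((M.rename f).den ρ').toFun ((N.rename f).den ρ') = (M.den ρ).toFun (N.den ρ)
    rw [ihM f ρ ρ' h, ihN f ρ ρ' h]
  | fix M ih => exact congrArg ScottMap.fix (ih f ρ ρ' h)

theorem Tm.den_subst (M : Tm Γ t) {Δ : Ctx} (σ : ∀ t, Var Γ t → Tm Δ t) (ρ : Ctx.den Γ)
    (ρ' : Ctx.den Δ) (h : ∀ t x, (σ t x).den ρ' = x.den ρ) : (M.subst σ).den ρ' = M.den ρ := by
  -- Under a binder both environments gain the same value `z`. A weakened term ignores it, by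
  -- `Tm.den_rename`.
  have lift : ∀ {Γ Δ : Ctx} (σ : ∀ t, Var Γ t → Tm Δ t) (ρ : Ctx.den Γ) (ρ' : Ctx.den Δ),
      (∀ t x, (σ t x).den ρ' = x.den ρ) → ∀ (u : Ty) (z : u.den) (t : Ty) (x : Var (u :: Γ) t),
      (liftSub σ t x).den (z, ρ') = x.den (z, ρ) := by
    intro Γ Δ σ ρ ρ' h u z t x
    cases x with
    | zero => rfl
    | succ x => exact (Tm.den_rename (Δ := u :: Δ) (σ _ x) (fun _ => .succ) ρ' (z, ρ') fun _ _ => rfl).trans (h _ x)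
  induction M generalizing Δ with
  | var x => exact h _ x
  | num n => rfl
  | coin p hp => rfl
  | succ M ih => exact congrArg PPCF.shift (ih σ ρ ρ' h)
  | ifz M P Q ihM ihP ihQ =>
    have hQ : ∀ z, (Q.subst (liftSub σ)).den (z, ρ') = Q.den (z, ρ) := fun z =>
      ihQ _ _ _ (lift σ ρ ρ' h _ z)
    change ifDen ((M.subst σ).den ρ') ((P.subst σ).den ρ')
      (fun z => (Q.subst (liftSub σ)).den (z, ρ')) = ifDen (M.den ρ) (P.den ρ)
      (fun z => Q.den (z, ρ))
    rw [ihM σ ρ ρ' h, ihP σ ρ ρ' h]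
    congr 1
    exact funext hQ
  | lam M ih => exact ScottMap.ext fun z => ih (liftSub σ) (z, ρ) (z, ρ') (lift σ ρ ρ' h _ z)
  | app M N ihM ihN =>
    change ((M.subst σ).den ρ').toFun ((N.subst σ).den ρ') = (M.den ρ).toFun (N.den ρ)
    rw [ihM σ ρ ρ' h, ihN σ ρ ρ' h]
  | fix M ih => exact congrArg ScottMap.fix (ih σ ρ ρ' h)

theorem Tm.den_inst (M : Tm (u :: Γ) t) (N : Tm Γ u) (ρ : Ctx.den Γ) :
    (M.inst N).den ρ = M.den (N.den ρ, ρ) := by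
  refine Tm.den_subst M _ _ _ fun t x => ?_
  cases x <;> rfl

end Substitution

/-! ### Suprema of sequences and countable sums -/

theorem isLUB_of_scott {X Y : Type} [Preorder X] [Preorder Y] {g : X → Y} (hg : ScottContinuous g)
    {a : ℕ → X} (ha : Monotone a) {l : X} (hl : IsLUB (Set.range a) l) :
    IsLUB (Set.range fun k => g (a k)) (g l) := by
  have := hg (Set.range_nonempty a) ha.directed_le.directedOn_range hl
  rwa [← Set.range_comp] at this

theorem isLUB_iSup_of_monotone {X : Type} [CompletePartialOrder X] {a : ℕ → X} (ha : Monotone a) :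
    IsLUB (Set.range a) (⨆ k, a k) :=
  ha.directed_le.directedOn_range.isLUB_sSup

theorem trunc_bind {n m : ℕ} (r : SubDist (Fin n)) (v : Fin n → SubDist ℕ) :
    (r.bind v).trunc m = r.bind fun i => (v i).trunc m := rfl

theorem trunc_zero (m : ℕ) : SubDist.zero.trunc m = SubDist.zero := rfl

theorem trunc_dirac {m i : ℕ} (h : i < m) :
    (SubDist.dirac i).trunc m = SubDist.dirac ⟨i, h⟩ := by
  ext j
  simp [SubDist.trunc, SubDist.dirac, Fin.ext_iff]

section CountableSum

variable {X : Type} [Kegelspitze X]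

theorem isLUB_csum (v : SubDist ℕ) (x : ℕ → X) :
    IsLUB (Set.range fun n : ℕ => Kegelspitze.comb (v.trunc n) (fun i : Fin n => x i))
      (csum v x) :=
  isLUB_iSup_of_monotone (csum_mono v x)

theorem csum_zero (x : ℕ → X) : csum SubDist.zero x = ⊥ := by
  refine (isLUB_csum SubDist.zero x).unique ?_
  simp only [trunc_zero, Kegelspitze.comb_zero, Set.range_const]
  exact isLUB_singleton

/-- The partial sums are constantly `x i` as soon as they include the index `i`. -/
theorem csum_dirac (i : ℕ) (x : ℕ → X) : csum (SubDist.dirac i) x = x i := by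
  have key : ∀ n : ℕ, i < n →
      Kegelspitze.comb ((SubDist.dirac i).trunc n) (fun i : Fin n => x i) = x i := fun n h => by
    rw [trunc_dirac h, Kegelspitze.comb_dirac]
  refine (isLUB_csum _ x).unique ⟨?_, fun y hy => ?_⟩
  · rintro _ ⟨n, rfl⟩
    refine (csum_mono (SubDist.dirac i) x (le_max_left n (i + 1))).trans (key _ ?_).le
    omega
  · rw [← key (i + 1) i.lt_succ_self]
    exact hy ⟨i + 1, rfl⟩

/-- Truncation commutes with mixtures, so the substitution law gives the identity for each partial
sum. Continuity of finite sums in their points then passes it to the supremum. -/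
theorem csum_bind {n : ℕ} (r : SubDist (Fin n)) (v : Fin n → SubDist ℕ) (x : ℕ → X) :
    csum (r.bind v) x = Kegelspitze.comb r fun i => csum (v i) x := by
  refine (isLUB_csum _ x).unique ?_
  simp only [trunc_bind, ← Kegelspitze.comb_comb]
  refine isLUB_of_scott (g := fun y : Fin n → X => Kegelspitze.comb r y)
    (a := fun m i => Kegelspitze.comb ((v i).trunc m) (fun i : Fin m => x i))
    (((ScottContinuous.const r).prodMk ScottContinuous.id).comp Kegelspitze.scott_comb)
    (fun _ _ h i => csum_mono (v i) x h) ?_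
  rw [isLUB_pi]
  intro i
  rw [← Set.range_comp]
  exact isLUB_csum (v i) x

end CountableSum

theorem ScottMap.monotone_iterate {X : Type} [CompletePartialOrder X] (f : ScottMap X X) :
    Monotone fun n => f.toFun^[n] ⊥ := by
  refine monotone_nat_of_le_succ fun n => ?_
  rw [Function.iterate_succ_apply]
  exact f.scott.monotone.iterate n bot_le

theorem ScottMap.isLUB_fix {X : Type} [CompletePartialOrder X] (f : ScottMap X X) :
    IsLUB (Set.range fun n => f.toFun^[n] ⊥) f.fix :=
  isLUB_iSup_of_monotone f.monotone_iterate

/-- Continuity moves `f` inside the supremum, where it only shifts the increasing sequence of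
iterates by one. -/
theorem ScottMap.fix_eq {X : Type} [CompletePartialOrder X] (f : ScottMap X X) :
    f.fix = f f.fix := by
  have h := isLUB_of_scott f.scott f.monotone_iterate f.isLUB_fix
  refine f.isLUB_fix.unique ⟨?_, fun y hy => h.2 ?_⟩
  · rintro _ ⟨n, rfl⟩
    refine (f.monotone_iterate n.le_succ).trans (h.1 ⟨n, ?_⟩)
    exact (Function.iterate_succ_apply' _ _ _).symm
  · rintro _ ⟨n, rfl⟩
    exact hy ⟨n + 1, Function.iterate_succ_apply' _ _ _⟩

/-- A Scott-continuous map on subdistributions on `ℕ` that preserves zero and subconvex sums. -/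
structure Linear {X : Type} [Kegelspitze X] (G : SubDist ℕ → X) : Prop where
  scott : ScottContinuous G
  zero : G SubDist.zero = ⊥
  bind : ∀ {n : ℕ} (r : SubDist (Fin n)) (v : Fin n → SubDist ℕ),
    G (r.bind v) = Kegelspitze.comb r fun i => G (v i)

theorem linear_csum {X : Type} [Kegelspitze X] (x : ℕ → X) : Linear fun v => csum v x :=
  ⟨(ScottContinuous.id.prodMk (ScottContinuous.const x)).comp scott_csum, csum_zero x,
    fun r v => csum_bind r v x⟩

theorem linear_shift : Linear shift where
  scott := scott_shift
  zero := by ext n; cases n <;> rfl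
  bind r v := by
    ext n
    cases n with
    | zero => exact (by simp : (0 : ℝ≥0∞) = ∑' i, r i * 0)
    | succ n => rfl

theorem shift_dirac (n : ℕ) : shift (SubDist.dirac n) = SubDist.dirac (n + 1) := by
  ext m
  cases m <;> simp [shift, SubDist.dirac]

/-! ### One-step reduction as a subconvex sum -/

section Steps

variable {Γ : Ctx} {t u : Ty}

theorem prob_of_red {M M' : Tm Γ t} {p : ℚ} (h : Red M p M') :
    prob M M' = ENNReal.ofReal (p : ℝ) := by
  have hex : ∃ p, Red M p M' := ⟨p, h⟩
  rw [prob, dif_pos hex, hex.choose_spec.unique h rfl]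

theorem prob_of_not_red {M M' : Tm Γ t} (h : ∀ p, ¬ Red M p M') (hM : ¬ WeakNormal M) :
    prob M M' = 0 := by
  rw [prob, dif_neg (not_exists.2 h), if_neg fun h' => hM h'.2]

theorem probPow_succ_of_weakNormal {M : Tm Γ t} (hM : WeakNormal M) (k : ℕ) (M' : Tm Γ t) :
    probPow (k + 1) M M' = probPow k M M' := by
  rw [probPow, tsum_eq_single M]
  · rw [prob, dif_neg (not_exists.2 fun p => hM p M), if_pos ⟨rfl, hM⟩, one_mul]
  · intro N hN
    rw [prob, dif_neg (not_exists.2 fun p => hM p N), if_neg fun h => hN h.1.symm, zero_mul]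

/-- The term `M` is not weak-normal, and in one step it reduces to the terms `N i` with the
probabilities `r i`. -/
structure Steps (M : Tm Γ t) {n : ℕ} (r : SubDist (Fin n)) (N : Fin n → Tm Γ t) : Prop where
  not_weakNormal : ¬ WeakNormal M
  -- Testing against an arbitrary `g` requires no distinctness of the `N i`, and makes transport
  -- along a frame a reindexing of the sum.
  tsum_prob : ∀ g : Tm Γ t → ℝ≥0∞, ∑' M', prob M M' * g M' = ∑ i, r i * g (N i)

theorem Steps.probPow_succ {M : Tm Γ t} {n : ℕ} {r : SubDist (Fin n)} {N : Fin n → Tm Γ t}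
    (h : Steps M r N) (k : ℕ) (M' : Tm Γ t) :
    probPow (k + 1) M M' = ∑ i, r i * probPow k (N i) M' :=
  h.tsum_prob fun N => probPow k N M'

theorem steps_of_red_iff {M M' : Tm Γ t} (h : ∀ p N, Red M p N ↔ p = 1 ∧ N = M') :
    Steps M (SubDist.dirac (0 : Fin 1)) fun _ => M' := by
  have hr : Red M 1 M' := (h 1 M').2 ⟨rfl, rfl⟩
  have hM : ¬ WeakNormal M := fun hM => hM _ _ hr
  refine ⟨hM, fun g => ?_⟩
  rw [tsum_eq_single M' fun N hN => ?_]
  · simp [prob_of_red hr, SubDist.dirac]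
  · rw [prob_of_not_red (fun p hp => hN ((h p N).1 hp).2) hM, zero_mul]

theorem steps_beta (M : Tm (u :: Γ) t) (N : Tm Γ u) :
    Steps (.app (.lam M) N) (SubDist.dirac (0 : Fin 1)) fun _ => M.inst N := by
  refine steps_of_red_iff fun p L => ⟨fun h => ?_, ?_⟩
  · cases h with
    | beta => exact ⟨rfl, rfl⟩
    | app _ h => cases h
  · rintro ⟨rfl, rfl⟩
    exact .beta M N

theorem steps_fix (M : Tm Γ (Ty.arr t t)) :
    Steps (.fix M) (SubDist.dirac (0 : Fin 1)) fun _ => .app M (.fix M) := by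
  refine steps_of_red_iff fun p L => ⟨fun h => ?_, ?_⟩
  · cases h
    exact ⟨rfl, rfl⟩
  · rintro ⟨rfl, rfl⟩
    exact .fix M

theorem steps_succ_num (n : ℕ) :
    Steps (Tm.succ (Γ := Γ) (.num n)) (SubDist.dirac (0 : Fin 1)) fun _ => .num (n + 1) := by
  refine steps_of_red_iff fun p L => ⟨fun h => ?_, ?_⟩
  · cases h with
    | succ_num => exact ⟨rfl, rfl⟩
    | succ h => cases h
  · rintro ⟨rfl, rfl⟩
    exact .succ_num n

theorem steps_ifz_zero (P : Tm Γ t) (Q : Tm (Ty.nat :: Γ) t) :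
    Steps (.ifz (.num 0) P Q) (SubDist.dirac (0 : Fin 1)) fun _ => P := by
  refine steps_of_red_iff fun p L => ⟨fun h => ?_, ?_⟩
  · cases h with
    | ifz_zero => exact ⟨rfl, rfl⟩
    | ifz _ _ h => cases h
  · rintro ⟨rfl, rfl⟩
    exact .ifz_zero _ Q

theorem steps_ifz_succ (n : ℕ) (P : Tm Γ t) (Q : Tm (Ty.nat :: Γ) t) :
    Steps (.ifz (.num (n + 1)) P Q) (SubDist.dirac (0 : Fin 1)) fun _ => Q.inst (.num n) := by
  refine steps_of_red_iff fun p L => ⟨fun h => ?_, ?_⟩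
  · cases h with
    | ifz_succ => exact ⟨rfl, rfl⟩
    | ifz _ _ h => cases h
  · rintro ⟨rfl, rfl⟩
    exact .ifz_succ n P Q

/-- The weights `p` and `1 - p`. -/
noncomputable def coinWeights (p : ℚ) (hp : p ∈ Set.Icc (0 : ℚ) 1) : SubDist (Fin 2) :=
  ⟨![ENNReal.ofReal (p : ℝ), ENNReal.ofReal (1 - p : ℝ)], by
    have h0 : (0 : ℝ) ≤ p := by exact_mod_cast hp.1
    have h1 : (0 : ℝ) ≤ 1 - p := by
      have : (p : ℝ) ≤ 1 := by exact_mod_cast hp.2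
      linarith
    simp [tsum_fintype, ← ENNReal.ofReal_add h0 h1]⟩

theorem coinDist_eq (p : ℚ) (hp : p ∈ Set.Icc (0 : ℚ) 1) :
    coinDist p hp = Kegelspitze.comb (coinWeights p hp) fun i => SubDist.dirac (i : ℕ) := by
  ext n
  exact ((tsum_fintype fun i : Fin 2 => coinWeights p hp i * SubDist.dirac (i : ℕ) n).trans
    (Fin.sum_univ_two _)).symm

open Classical in
theorem steps_coin (p : ℚ) (hp : p ∈ Set.Icc (0 : ℚ) 1) :
    Steps (Tm.coin (Γ := Γ) p hp) (coinWeights p hp) fun i => .num i := by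
  have h0 := Red.coin_zero (Γ := Γ) p hp
  have h1 := Red.coin_one (Γ := Γ) p hp
  -- A reduction of probability 0 is still a reduction, so the case `p = 0` needs no separate
  -- treatment.
  have hM : ¬ WeakNormal (Tm.coin (Γ := Γ) p hp) := fun hM => hM _ _ h0
  refine ⟨hM, fun g => ?_⟩
  rw [tsum_eq_sum (s := ({Tm.num 0, Tm.num 1} : Finset (Tm Γ Ty.nat)))]
  · rw [Finset.sum_pair (by simp), Fin.sum_univ_two, prob_of_red h0, prob_of_red h1]
    simp [coinWeights]
  · intro N hN
    rw [prob_of_not_red _ hM, zero_mul]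
    intro q h
    cases h <;> simp at hN

/-- An evaluation frame. -/
structure Frame (C : Tm Γ u → Tm Γ t) : Prop where
  inj : Function.Injective C
  red : ∀ {M p M'}, Red M p M' → Red (C M) p (C M')
  inv : ∀ {M p N}, ¬ WeakNormal M → Red (C M) p N → ∃ M', Red M p M' ∧ C M' = N

theorem Frame.steps {C : Tm Γ u → Tm Γ t} (hC : Frame C) {M : Tm Γ u} {n : ℕ}
    {r : SubDist (Fin n)} {N : Fin n → Tm Γ u} (h : Steps M r N) :
    Steps (C M) r fun i => C (N i) := by
  have hM := h.not_weakNormal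
  have hCM : ¬ WeakNormal (C M) := fun h' => hM fun p M' hr => h' p _ (hC.red hr)
  have hprob : ∀ M', prob (C M) (C M') = prob M M' := fun M' => by
    by_cases hr : ∃ p, Red M p M'
    · obtain ⟨p, hr⟩ := hr
      rw [prob_of_red hr, prob_of_red (hC.red hr)]
    · rw [prob_of_not_red (not_exists.1 hr) hM, prob_of_not_red _ hCM]
      intro p h'
      obtain ⟨L, hL, e⟩ := hC.inv hM h'
      exact hr ⟨p, hC.inj e ▸ hL⟩
  refine ⟨hCM, fun g => ?_⟩
  rw [← h.tsum_prob fun L => g (C L)]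
  -- Every reduct of `C M` lies in the range of `C`, so the sum over all terms reindexes along the
  -- injection `C`.
  rw [← hC.inj.tsum_eq (f := fun M' => prob (C M) M' * g M')]
  · simp only [hprob]
  · intro L hL
    by_contra hL'
    refine hL ?_
    simp only
    rw [prob_of_not_red _ hCM, zero_mul]
    intro p h'
    obtain ⟨L', -, e⟩ := hC.inv hM h'
    exact hL' ⟨L', e⟩

theorem frame_app (P : Tm Γ u) : Frame fun M : Tm Γ (Ty.arr u t) => Tm.app M P where
  inj M N h := by simpa using h
  red h := .app P h
  inv {M p N} hM h := by
    generalize hL : Tm.app M P = L at h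
    cases h <;> cases hL
    case app h => exact ⟨_, h, rfl⟩
    -- Here the frame itself forms the redex. Its hole is then an abstraction, which is weak-normal,
    -- contrary to `hM`.
    case beta => exact absurd (fun _ _ h => by cases h) hM

theorem frame_succ : Frame (Tm.succ (Γ := Γ)) where
  inj M N h := by simpa using h
  red h := .succ h
  inv {M p N} hM h := by
    cases h with
    | succ h => exact ⟨_, h, rfl⟩
    | succ_num => exact absurd (fun _ _ h => by cases h) hM

theorem frame_ifz (P : Tm Γ t) (Q : Tm (Ty.nat :: Γ) t) : Frame fun M => Tm.ifz M P Q where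
  inj M N h := by simpa using h
  red h := .ifz P Q h
  inv {M p N} hM h := by
    generalize hL : Tm.ifz M P Q = L at h
    cases h <;> cases hL
    case ifz h => exact ⟨_, h, rfl⟩
    case ifz_zero => exact absurd (fun _ _ h => by cases h) hM
    case ifz_succ => exact absurd (fun _ _ h => by cases h) hM

/-! ### Soundness -/

theorem weakNormal_num (n : ℕ) : WeakNormal (Tm.num (Γ := Γ) n) := fun _ _ h => by cases h

theorem ifDen_dirac_zero {X : Type} [Kegelspitze X] (x : X) (w : SubDist ℕ → X) :
    ifDen (SubDist.dirac 0) x w = x := csum_dirac _ _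

theorem ifDen_dirac_succ {X : Type} [Kegelspitze X] (n : ℕ) (x : X) (w : SubDist ℕ → X) :
    ifDen (SubDist.dirac (n + 1)) x w = w (SubDist.dirac n) := csum_dirac _ _

theorem linear_ifDen {X : Type} [Kegelspitze X] (x : X) (w : SubDist ℕ → X) :
    Linear fun v => ifDen v x w := linear_csum _

/-- A term either is weak-normal or denotes the subconvex sum of its one-step reducts. -/
theorem weakNormal_or_steps (M : Tm Γ t) : WeakNormal M ∨
    ∃ (n : ℕ) (r : SubDist (Fin n)) (N : Fin n → Tm Γ t), Steps M r N ∧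
      ∀ ρ, M.den ρ = Kegelspitze.comb r fun i => (N i).den ρ := by
  induction M with
  | var x => exact .inl fun _ _ h => by cases h
  | num n => exact .inl (weakNormal_num n)
  | lam M => exact .inl fun _ _ h => by cases h
  | coin p hp => exact .inr ⟨_, _, _, steps_coin p hp, fun ρ => coinDist_eq p hp⟩
  | @fix Γ t M =>
    refine .inr ⟨_, _, _, steps_fix M, fun ρ => ?_⟩
    rw [Kegelspitze.comb_dirac]
    exact ScottMap.fix_eq (X := t.den) (M.den ρ)
  | succ M ih =>
    obtain hM | ⟨n, r, N, h, hd⟩ := ih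
    -- A weak-normal argument that is not a numeral, such as a variable, leaves the successor stuck.
    -- Hence the dichotomy also holds for open terms.
    · by_cases hn : ∃ n, M = .num n
      · obtain ⟨n, rfl⟩ := hn
        refine .inr ⟨_, _, _, steps_succ_num n, fun ρ => ?_⟩
        rw [Kegelspitze.comb_dirac]
        exact shift_dirac n
      · refine .inl fun p L h => ?_
        cases h with
        | succ h => exact hM _ _ h
        | succ_num n => exact hn ⟨n, rfl⟩
    · exact .inr ⟨_, _, _, frame_succ.steps h, fun ρ =>
        (congrArg shift (hd ρ)).trans (linear_shift.bind r _)⟩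
  | ifz M P Q ih =>
    obtain hM | ⟨n, r, N, h, hd⟩ := ih
    · by_cases hn : ∃ n, M = .num n
      · obtain ⟨_ | n, rfl⟩ := hn
        · refine .inr ⟨_, _, _, steps_ifz_zero P Q, fun ρ => ?_⟩
          rw [Kegelspitze.comb_dirac]
          exact ifDen_dirac_zero (P.den ρ) fun z => Q.den (z, ρ)
        · refine .inr ⟨_, _, _, steps_ifz_succ n P Q, fun ρ => ?_⟩
          rw [Kegelspitze.comb_dirac, Tm.den_inst]
          exact ifDen_dirac_succ n (P.den ρ) fun z => Q.den (z, ρ)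
      · refine .inl fun p L h => ?_
        cases h with
        | ifz _ _ h => exact hM _ _ h
        | ifz_zero => exact hn ⟨0, rfl⟩
        | ifz_succ n => exact hn ⟨n + 1, rfl⟩
    · exact .inr ⟨_, _, _, (frame_ifz P Q).steps h, fun ρ =>
        (congrArg (fun v => ifDen v (P.den ρ) fun z => Q.den (z, ρ)) (hd ρ)).trans
          ((linear_ifDen _ _).bind r _)⟩
  | app M P ih =>
    obtain hM | ⟨n, r, N, h, hd⟩ := ih
    · by_cases hn : ∃ L, M = .lam L
      · obtain ⟨L, rfl⟩ := hn
        refine .inr ⟨_, _, _, steps_beta L P, fun ρ => ?_⟩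
        rw [Kegelspitze.comb_dirac, Tm.den_inst]
        rfl
      · refine .inl fun p L h => ?_
        cases h with
        | app _ h => exact hM _ _ h
        | beta => exact hn ⟨_, rfl⟩
    -- Sums of functions are pointwise, so application is linear in the function.
    · exact .inr ⟨_, _, _, (frame_app P).steps h, fun ρ =>
        congrArg (fun f => ScottMap.toFun f (P.den ρ)) (hd ρ)⟩

end Steps

/-- This is the soundness half. Splitting off the first step expresses both sides as the same
mixture over the reducts, while a weak-normal term only loops. -/
theorem probPow_num_le_denNat (k : ℕ) (M : Tm [] Ty.nat) (n : ℕ) :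
    probPow k M (.num n) ≤ denNat M n := by
  induction k generalizing M with
  | zero =>
    rw [probPow]
    split_ifs with h
    · subst h
      exact (by simp [SubDist.dirac] : (1 : ℝ≥0∞) ≤ SubDist.dirac n n)
    · exact zero_le
  | succ k ih =>
    obtain hM | ⟨m, r, N, h, hd⟩ := weakNormal_or_steps M
    · exact (probPow_succ_of_weakNormal hM k _).trans_le (ih M)
    · rw [h.probPow_succ, denNat, hd ()]
      exact (Finset.sum_le_sum fun i _ => mul_le_mul_right (ih (N i)) _).trans
        (tsum_fintype (fun i => r i * denNat (N i) n)).ge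

/-! ### The distribution of the numerals reached after a number of steps -/

/-- A numeral is weak-normal, so the matrix keeps at it all the mass that has arrived. -/
theorem probPow_num_mono (n : ℕ) (M : Tm [] Ty.nat) : Monotone fun k => probPow k M (.num n) := by
  refine monotone_nat_of_le_succ fun k => ?_
  induction k generalizing M with
  | zero =>
    by_cases h : M = .num n
    · subst h
      exact (probPow_succ_of_weakNormal (weakNormal_num n) 0 _).ge
    · simp [probPow, h]
  | succ k ih =>
    obtain hM | ⟨m, r, N, h, -⟩ := weakNormal_or_steps M
    · exact (probPow_succ_of_weakNormal hM (k + 1) _).ge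
    · simp only [h.probPow_succ]
      exact Finset.sum_le_sum fun i _ => mul_le_mul_right (ih (N i)) _

/-- The subdistribution of the numerals that `M` has reached after `k` steps. -/
noncomputable def reached (k : ℕ) (M : Tm [] Ty.nat) : SubDist ℕ :=
  ⟨fun n => probPow k M (.num n), by
    classical
    induction k generalizing M with
    | zero =>
      by_cases h : ∃ n, M = .num n
      · obtain ⟨n, rfl⟩ := h
        simp [probPow]
      · simp [probPow, fun n => not_exists.1 h n]
    | succ k ih =>
      obtain hM | ⟨m, r, N, h, -⟩ := weakNormal_or_steps M
      · simpa only [probPow_succ_of_weakNormal hM] using ih M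
      · simp only [h.probPow_succ]
        rw [Summable.tsum_finsetSum fun _ _ => ENNReal.summable]
        simp only [ENNReal.tsum_mul_left]
        exact (Finset.sum_le_sum fun i _ => mul_le_of_le_one_right' (ih (N i))).trans
          ((tsum_fintype r.toFun).symm.trans_le r.tsum_le)⟩

theorem reached_mono (M : Tm [] Ty.nat) : Monotone fun k => reached k M :=
  fun _ _ h n => probPow_num_mono n M h

theorem reached_zero_num (n : ℕ) : reached 0 (.num n) = SubDist.dirac n := by
  ext m
  simp [reached, probPow, SubDist.dirac, eq_comm]

theorem reached_zero_of_ne_num {M : Tm [] Ty.nat} (h : ∀ n, M ≠ .num n) :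
    reached 0 M = SubDist.zero := by
  ext m
  simp [reached, probPow, SubDist.zero, h]

theorem Steps.reached_succ {M : Tm [] Ty.nat} {n : ℕ} {r : SubDist (Fin n)}
    {N : Fin n → Tm [] Ty.nat} (h : Steps M r N) (k : ℕ) :
    reached (k + 1) M = r.bind fun i => reached k (N i) := by
  ext m
  exact (h.probPow_succ k _).trans
    (tsum_fintype fun i => r i * reached k (N i) m).symm

theorem reached_succ_of_weakNormal {M : Tm [] Ty.nat} (h : WeakNormal M) (k : ℕ) :
    reached (k + 1) M = reached k M := by
  ext m
  exact probPow_succ_of_weakNormal h k _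

/-- The probabilities increase with `k`, so one common `k` serves all reducts and the supremum
leaves the finite sum. The initial step turns `k` into `k + 1`. -/
theorem Steps.sum_probInf_le {M : Tm [] Ty.nat} {m : ℕ} {r : SubDist (Fin m)}
    {N : Fin m → Tm [] Ty.nat} (h : Steps M r N) (n : ℕ) :
    ∑ i, r i * probInf (N i) (.num n) ≤ probInf M (.num n) := by
  simp only [probInf, ENNReal.mul_iSup]
  rw [ENNReal.finsetSum_iSup_of_monotone
    fun i _ _ hk => mul_le_mul_right (probPow_num_mono n (N i) hk) (r i)]
  refine iSup_le fun k => ?_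
  rw [← h.probPow_succ]
  exact le_iSup (fun k => probPow k M (.num n)) (k + 1)

/-! ### The logical relation -/

/-- The logical relation between denotations and closed terms: at type `nat` it says that the
numerals have at least the given probabilities. -/
def Approx : ∀ {t : Ty}, t.den → Tm [] t → Prop
  | .nat, (x : SubDist ℕ), M => ∀ n, x n ≤ probInf M (.num n)
  | .arr u _, f, M => ∀ (x : u.den) N, Approx x N → Approx (ScottMap.toFun f x) (.app M N)

theorem Approx.of_le {t : Ty} {x y : t.den} {M : Tm [] t} (h : Approx y M) (hxy : x ≤ y) :
    Approx x M := by
  induction t with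
  | nat => exact fun n => (hxy n).trans (h n)
  | arr u t _ ih => exact fun z N hz => ih (h z N hz) (hxy z)

theorem Approx.bot {t : Ty} (M : Tm [] t) : Approx (⊥ : t.den) M := by
  induction t with
  | nat => exact fun n => zero_le
  | arr u t _ ih => exact fun z N hz => ih (.app M N)

/-- Evaluation at a natural number, or at an argument, is Scott-continuous, so the supremum can be
tested after evaluation. -/
theorem Approx.of_isLUB {t : Ty} {d : Set t.den} (hne : d.Nonempty) (hd : DirectedOn (· ≤ ·) d)
    {a : t.den} (ha : IsLUB d a) {M : Tm [] t} (h : ∀ x ∈ d, Approx x M) : Approx a M := by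
  induction t with
  | nat =>
    refine fun n => (SubDist.scott_apply n hne hd ha).2 ?_
    rintro _ ⟨x, hx, rfl⟩
    exact h x hx n
  | arr u t _ ih =>
    intro z N hz
    refine ih (hne.image _) (ScottMap.directedOn_apply hd z) (ScottMap.scott_apply z hne hd ha) ?_
    rintro _ ⟨f, hf, rfl⟩
    exact h f hf z N hz

theorem Approx.of_isLUB_range {t : Ty} {x : ℕ → t.den} (hx : Monotone x) {a : t.den}
    (ha : IsLUB (Set.range x) a) {M : Tm [] t} (h : ∀ k, Approx (x k) M) : Approx a M :=
  Approx.of_isLUB (Set.range_nonempty x) hx.directed_le.directedOn_range ha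
    (Set.forall_mem_range.2 h)

/-- At a function type, applying to `P` is a frame: the applications take the same step with the
same weights, and the sum is evaluated pointwise. -/
theorem Approx.of_steps {t : Ty} {M : Tm [] t} {n : ℕ} {r : SubDist (Fin n)} {N : Fin n → Tm [] t}
    (h : Steps M r N) {x : Fin n → t.den} (hx : ∀ i, Approx (x i) (N i)) :
    Approx (Kegelspitze.comb r x) M := by
  induction t with
  | nat =>
    refine fun m => le_trans ?_ (h.sum_probInf_le m)
    refine (tsum_fintype fun i => r i * SubDist.toFun (x i) m).trans_le ?_
    exact Finset.sum_le_sum fun i _ => mul_le_mul_right (hx i m) _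
  | arr u t _ ih => exact fun z P hz => ih ((frame_app P).steps h) fun i => hx i z P hz

theorem Approx.of_steps_dirac {t : Ty} {M N : Tm [] t}
    (h : Steps M (SubDist.dirac (0 : Fin 1)) fun _ => N) {x : t.den} (hx : Approx x N) :
    Approx x M := by
  have := Approx.of_steps h (x := fun _ => x) fun _ => hx
  rwa [Kegelspitze.comb_dirac] at this

/-- A frame around a term of type `nat` and a linear map are related if they are related at the
numerals. -/
theorem Approx.frame {t : Ty} {C : Tm [] Ty.nat → Tm [] t} (hC : Frame C)
    {G : SubDist ℕ → t.den} (hG : Linear G) (h : ∀ n, Approx (G (SubDist.dirac n)) (C (.num n)))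
    {v : SubDist ℕ} {M : Tm [] Ty.nat} (hv : Approx (t := .nat) v M) : Approx (G v) (C M) := by
  -- Induction on `k` for all `M` at once: linearity of `G` splits `reached (k + 1) M` over the
  -- reducts, and the frame lets `C M` take the same step.
  have key : ∀ k M, Approx (G (reached k M)) (C M) := by
    intro k
    induction k with
    | zero =>
      intro M
      by_cases hM : ∃ n, M = .num n
      · obtain ⟨n, rfl⟩ := hM
        rw [reached_zero_num]
        exact h n
      · rw [reached_zero_of_ne_num (not_exists.1 hM), hG.zero]
        exact Approx.bot _
    | succ k ih =>
      intro M
      obtain hM | ⟨m, r, N, hs, -⟩ := weakNormal_or_steps M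
      · rw [reached_succ_of_weakNormal hM]
        exact ih M
      · rw [hs.reached_succ, hG.bind]
        exact Approx.of_steps (hC.steps hs) fun i => ih (N i)
  have lub := isLUB_iSup_of_monotone (reached_mono M)
  -- The hypothesis on `v` says exactly that `v` lies below the limit of the reached
  -- subdistributions. Monotonicity of `G` and downward closure of the relation finish the proof.
  have hle : v ≤ ⨆ k, reached k M := fun n => (hv n).trans <| iSup_le fun k => lub.1 ⟨k, rfl⟩ n
  exact (Approx.of_isLUB_range (hG.scott.monotone.comp (reached_mono M))
    (isLUB_of_scott hG.scott (reached_mono M) lub) fun k => key k M).of_le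
      (hG.scott.monotone hle)

/-- The fundamental lemma of the logical relation. -/
theorem Tm.approx_den {Γ : Ctx} {t : Ty} (M : Tm Γ t) (ρ : Ctx.den Γ) (σ : ∀ t, Var Γ t → Tm [] t)
    (h : ∀ t (x : Var Γ t), Approx (x.den ρ) (σ t x)) : Approx (M.den ρ) (M.subst σ) := by
  have cons : ∀ {Γ : Ctx} (ρ : Ctx.den Γ) (σ : ∀ t, Var Γ t → Tm [] t),
      (∀ t (x : Var Γ t), Approx (x.den ρ) (σ t x)) → ∀ {u : Ty} (z : u.den) (N : Tm [] u),
      Approx z N → ∀ t (x : Var (u :: Γ) t), Approx (x.den (z, ρ)) (consSub N σ t x) := by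
    intro Γ ρ σ h u z N hz t x
    cases x with
    | zero => exact hz
    | succ x => exact h t x
  have num : ∀ n, Approx (t := .nat) (SubDist.dirac n) (.num n) := fun n m => by
    rw [← reached_zero_num]
    exact le_iSup (fun k => probPow k (.num n) (.num m)) 0
  induction M with
  | var x => exact h _ x
  | num n => exact num n
  | coin p hp =>
    change Approx (t := .nat) (coinDist p hp) _
    rw [coinDist_eq]
    exact Approx.of_steps (t := .nat) (steps_coin p hp) fun i => num i
  | succ M ih =>
    refine Approx.frame (t := .nat) frame_succ linear_shift (fun n => ?_) (ih ρ σ h)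
    rw [shift_dirac]
    exact Approx.of_steps_dirac (t := .nat) (steps_succ_num n) (num _)
  | @ifz Γ t M P Q ihM ihP ihQ =>
    refine Approx.frame (frame_ifz (P.subst σ) (Q.subst (liftSub σ)))
      (linear_ifDen (P.den ρ) fun z => Q.den (z, ρ)) (fun n => ?_) (ihM ρ σ h)
    cases n with
    | zero =>
      rw [ifDen_dirac_zero]
      exact Approx.of_steps_dirac (steps_ifz_zero _ _) (ihP ρ σ h)
    | succ n =>
      rw [ifDen_dirac_succ]
      refine Approx.of_steps_dirac (steps_ifz_succ n _ _) ?_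
      rw [Tm.inst_subst_liftSub]
      exact ihQ _ _ (cons ρ σ h (u := .nat) _ _ (num n))
  | lam M ih =>
    intro z N hz
    refine Approx.of_steps_dirac (steps_beta _ N) ?_
    rw [Tm.inst_subst_liftSub]
    exact ih _ _ (cons ρ σ h z N hz)
  | app M N ihM ihN => exact ihM ρ σ h _ _ (ihN ρ σ h)
  | @fix Γ t M ih =>
    let f : ScottMap t.den t.den := M.den ρ
    -- It suffices to relate each iterate to the whole term `fix M`. Unfolding the term once matches
    -- one further application of `f`.
    refine Approx.of_isLUB_range f.monotone_iterate f.isLUB_fix fun k => ?_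
    induction k with
    | zero => exact Approx.bot _
    | succ k ihk =>
      rw [Function.iterate_succ_apply']
      exact Approx.of_steps_dirac (steps_fix _) (ih ρ σ h _ _ ihk)

end PPCF

theorem mainTheorem4 (M : PPCF.Tm [] PPCF.Ty.nat) (n : ℕ) :
    PPCF.denNat M n = PPCF.probInf M (PPCF.Tm.num n) := by
  refine le_antisymm ?_ (iSup_le fun k => PPCF.probPow_num_le_denNat k M n)
  -- The context is empty, so the hypothesis on variables is vacuous and the identity serves as
  -- closing substitution.
  have h := M.approx_den () (fun _ x => .var x) (fun _ x => by cases x) n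
  rwa [PPCF.Tm.subst_var] at h
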